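/- Let $F,G\in\mathbb{R}[x_0,x_1,x_2,x_3]$ be homogeneous polynomials that are irreducible over $\mathbb{C}$. Let $R,S\subset\mathbb{P}^3_{\mathbb{R}}$ be the real surfaces $F=0$ and $G=0$, and let $R_{\mathbb{C}},S_{\mathbb{C}}\subset\mathbb{P}^3_{\mathbb{C}}$ be the complex zero loci of $F$ and $G$. Assume that $\dim_{\mathbb{R}}R=\dim_{\mathbb{R}}S=2$, where the dimension of a real projective algebraic set $X\subset\mathbb{P}^3_{\mathbb{R}}$ is one less than the Krull dimension of $\mathbb{R}[x_0,x_1,x_2,x_3]/I(X)$, with $I(X)$ the ideal of all real polynomials vanishing on the affine cone over $X$. A similarity is a real projective transformation of $\mathbb{P}^3$ given by a matrix $\begin{pmatrix}1&0\\ a&A\end{pmatrix}$ with $a\in\mathbb{R}^3$, $A\in\mathbb{R}^{3\times 3}$ and $A^{\top}A=\lambda I$ for some real $\lambda>0$; it is direct if $\det A>0$. Similarities act on both $\mathbb{P}^3_{\mathbb{R}}$ and $\mathbb{P}^3_{\mathbb{C}}$. Let $\mathrm{Sim}$ be the group of direct similarities and, for subsets $X,Y$ of $\mathbb{P}^3_{\mathbb{R}}$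 or of $\mathbb{P}^3_{\mathbb{C}}$, put $\mathrm{Sim}_{X,Y}=\{\phi\in\mathrm{Sim}:\phi(X)=Y\}$. Then $$\mathrm{Sim}_{R_{\mathbb{C}},S_{\mathbb{C}}}=\mathrm{Sim}_{R,S}.$$ The same equality holds with the group of all similarities, direct or not, in place of $\mathrm{Sim}$. -/

import Mathlib

open scoped LinearAlgebra.Projectivization MatrixGroups Pointwise

noncomputable section

namespace SimSurf

/-- Projective 3-space over a field `K`, with homogeneous coordinates `[x₀ : x₁ : x₂ : x₃]`;
the plane at infinity is `x₀ = 0`. -/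
abbrev P3 (K : Type*) [Field K] : Type _ := ℙ K (Fin 4 → K)

/-- A real projective transformation acts on complex projective space through the inclusion
`PGL(4, ℝ) → PGL(4, ℂ)`. -/
instance : MulAction PGL(4, ℝ) (P3 ℂ) :=
  MulAction.compHom _ (Matrix.ProjGenLinGroup.map Complex.ofRealHom)

/-- The set of equivalences `𝓖_{A,B} = {φ ∈ 𝓖 : φ(A) = B}` between two subsets `A`, `B` of a space
on which the transformations act. -/
def equivalences {T X : Type*} [Group T] [MulAction T X] (𝓖 : Set T) (A B : Set X) : Set T :=
  {φ | φ ∈ 𝓖 ∧ φ • A = B}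

/-- The zero locus of a homogeneous polynomial in projective 3-space. -/
def zeroLocus {K : Type*} [Field K] (F : MvPolynomial (Fin 4) K) : Set (P3 K) :=
  {p | ∀ (v : Fin 4 → K) (hv : v ≠ 0), Projectivization.mk K v hv = p → MvPolynomial.eval v F = 0}

/-- The linear part, on the affine chart `x₀ = 1`, of the transformation with matrix `M`
(meaningful if the first row of `M` is `(a₀₀, 0, 0, 0)` with `a₀₀ ≠ 0`). -/
def linearPart (M : Matrix (Fin 4) (Fin 4) ℝ) : Matrix (Fin 3) (Fin 3) ℝ :=
  (M 0 0)⁻¹ • M.submatrix Fin.succ Fin.succ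

/-- The matrix `M` represents a similarity: it maps the plane at infinity to itself (that is, its
first row is `(a₀₀, 0, 0, 0)` with `a₀₀ ≠ 0`), and its linear part `A` satisfies `Aᵀ A = c I`
for some `c > 0`. -/
def IsSimilarityMatrix (M : Matrix (Fin 4) (Fin 4) ℝ) : Prop :=
  M 0 0 ≠ 0 ∧ (∀ j : Fin 3, M 0 j.succ = 0) ∧
    ∃ c : ℝ, 0 < c ∧ (linearPart M).transpose * linearPart M = c • (1 : Matrix (Fin 3) (Fin 3) ℝ)

/-- The similarities of Euclidean 3-space, as real projective transformations. -/
def similarities : Set PGL(4, ℝ) :=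
  {φ | ∃ g : GL (Fin 4) ℝ, Matrix.ProjGenLinGroup.mk g = φ ∧ IsSimilarityMatrix g.val}

/-- The direct (orientation preserving) similarities of Euclidean 3-space. -/
def directSimilarities : Set PGL(4, ℝ) :=
  {φ | ∃ g : GL (Fin 4) ℝ, Matrix.ProjGenLinGroup.mk g = φ ∧ IsSimilarityMatrix g.val ∧
    0 < (linearPart g.val).det}

/-- The set of nonzero vectors that represent a point of `X` (the affine cone over `X` without
its vertex). -/
def coneOver (X : Set (P3 ℝ)) : Set (Fin 4 → ℝ) :=
  {v | ∃ hv : v ≠ 0, Projectivization.mk ℝ v hv ∈ X}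

/-- The real dimension of a real projective algebraic set `X` is `d`: the Krull dimension of its
homogeneous coordinate ring `ℝ[x₀, x₁, x₂, x₃] / I(X)`, where `I(X)` is the ideal of all real
polynomials that vanish at the real points of `X`, is `d + 1`. -/
def HasRealDim (X : Set (P3 ℝ)) (d : ℕ) : Prop :=
  ringKrullDim (MvPolynomial (Fin 4) ℝ ⧸ MvPolynomial.vanishingIdeal ℝ (coneOver X)) = d + 1

/-- The real surface given by `F`: the set of real points at which `F` vanishes. -/
def realSurface (F : MvPolynomial (Fin 4) ℝ) : Set (P3 ℝ) := zeroLocus F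

/-- The zero locus of `F` in complex projective 3-space. -/
def complexSurface (F : MvPolynomial (Fin 4) ℝ) : Set (P3 ℂ) :=
  zeroLocus (MvPolynomial.map (algebraMap ℝ ℂ) F)

end SimSurf

end

open MvPolynomial

namespace SimSurf

variable {K : Type*} [Field K]

/-! Since `R` has dimension 2, the irreducible form `F` generates the ideal of `R`
(`dvd_of_mem_vanishingIdeal`). If a real projective map `g` sends `R` into `S`, then `G ∘ g`
vanishes on `R`, so `F` divides `G ∘ g` over `ℝ`, hence over `ℂ`, and `g` sends `R_ℂ` into `S_ℂ`.
The converse restricts to real points. Nothing special to similarities enters: the argument works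
for any set of real projective transformations. -/

theorem eval_smul_of_isHomogeneous {F : MvPolynomial (Fin 4) K} {m : ℕ} (hF : F.IsHomogeneous m)
    (c : K) (v : Fin 4 → K) : eval (c • v) F = c ^ m * eval v F := by
  rw [eval_eq, eval_eq, Finset.mul_sum]
  refine Finset.sum_congr rfl fun d hd => ?_
  have hdeg : ∑ i, d i = m := by
    have h := hF (mem_support_iff.mp hd)
    rwa [Finsupp.weight_apply, Finsupp.sum_fintype _ _ (by simp), Finset.sum_congr rfl
      (fun i _ => by simp : ∀ i ∈ Finset.univ, d i • (1 : Fin 4 → ℕ) i = d i)] at h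
  have hprod : ∏ i ∈ d.support, c ^ d i = c ^ m := by
    rw [← hdeg, ← Finset.prod_pow_eq_pow_sum]
    exact Finset.prod_subset (Finset.subset_univ _) fun i _ hi => by
      simp [Finsupp.notMem_support_iff.mp hi]
  simp only [Pi.smul_apply, smul_eq_mul, mul_pow, Finset.prod_mul_distrib, hprod]
  ring

theorem mk_mem_zeroLocus {F : MvPolynomial (Fin 4) K} {m : ℕ} (hF : F.IsHomogeneous m)
    {v : Fin 4 → K} (hv : v ≠ 0) :
    Projectivization.mk K v hv ∈ zeroLocus F ↔ eval v F = 0 := by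
  refine ⟨fun h => h v hv rfl, fun h w hw hwv => ?_⟩
  obtain ⟨c, rfl⟩ := (Projectivization.mk_eq_mk_iff' K w v hw hv).mp hwv
  rw [eval_smul_of_isHomogeneous hF, h, mul_zero]

/-- Composition of a polynomial with the linear substitution given by a matrix. -/
noncomputable def linearSubst (M : Matrix (Fin 4) (Fin 4) K) :
    MvPolynomial (Fin 4) K →ₐ[K] MvPolynomial (Fin 4) K :=
  aeval fun i => ∑ j, C (M i j) * X j

theorem eval_linearSubst (M : Matrix (Fin 4) (Fin 4) K) (F : MvPolynomial (Fin 4) K)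
    (v : Fin 4 → K) : eval v (linearSubst M F) = eval (M.mulVec v) F := by
  induction F using MvPolynomial.induction_on with
  | C a => simp [linearSubst]
  | add p q hp hq => simp only [map_add, hp, hq]
  | mul_X p i hp =>
    rw [map_mul, map_mul, hp, map_mul, eval_X]
    simp [linearSubst, Matrix.mulVec, dotProduct]

theorem map_linearSubst {L : Type*} [Field L] (f : K →+* L) (M : Matrix (Fin 4) (Fin 4) K)
    (F : MvPolynomial (Fin 4) K) :
    map f (linearSubst M F) = linearSubst (M.map f) (map f F) := by
  induction F using MvPolynomial.induction_on with
  | C a => simp [linearSubst]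
  | add p q hp hq => simp only [map_add, hp, hq]
  | mul_X p i hp =>
    rw [map_mul, map_mul, hp, map_mul, map_mul, map_X]
    simp [linearSubst]

theorem smul_zeroLocus_subset_iff {F G : MvPolynomial (Fin 4) K} {m n : ℕ}
    (hF : F.IsHomogeneous m) (hG : G.IsHomogeneous n) (g : GL (Fin 4) K) :
    (Matrix.ProjGenLinGroup.mk g : PGL(4, K)) • zeroLocus F ⊆ zeroLocus G ↔
      ∀ v : Fin 4 → K, v ≠ 0 → eval v F = 0 → eval (g.val.mulVec v) G = 0 := by
  constructor
  · intro h v hv hvF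
    have := h (Set.smul_mem_smul_set ((mk_mem_zeroLocus hF hv).mpr hvF))
    rw [Projectivization.PGL.mk_smul_mk, mk_mem_zeroLocus hG] at this
    exact this
  · rintro h _ ⟨p, hp, rfl⟩
    induction p using Projectivization.ind with | _ v hv =>
    change (Matrix.ProjGenLinGroup.mk g : PGL(4, K)) • _ ∈ _
    rw [Projectivization.PGL.mk_smul_mk, mk_mem_zeroLocus hG]
    exact h v hv ((mk_mem_zeroLocus hF hv).mp hp)

/-- A real factorization is also a complex one, and a real polynomial that becomes a nonzero
constant over `ℂ` is already a nonzero constant. -/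
theorem irreducible_of_irreducible_map_complex {F : MvPolynomial (Fin 4) ℝ}
    (h : Irreducible (map (algebraMap ℝ ℂ) F)) : Irreducible F := by
  have key : ∀ p : MvPolynomial (Fin 4) ℝ, IsUnit (map (algebraMap ℝ ℂ) p) → IsUnit p := by
    intro p hp
    rw [MvPolynomial.isUnit_iff_eq_C_of_isReduced] at hp ⊢
    obtain ⟨r, hr, hpr⟩ := hp
    have hc : algebraMap ℝ ℂ (coeff 0 p) = r := by
      rw [← coeff_map, hpr, coeff_zero_C]
    refine ⟨coeff 0 p, IsUnit.mk0 _ fun h0 => hr.ne_zero (by rw [← hc, h0, map_zero]), ?_⟩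
    exact map_injective _ (algebraMap ℝ ℂ).injective (by rw [hpr, map_C, hc])
  refine ⟨fun hu => h.not_isUnit (hu.map _), fun {a b} hab => ?_⟩
  exact (h.isUnit_or_isUnit (by rw [hab, map_mul])).imp (key a) (key b)

/-- An irreducible form whose real zero locus is a surface generates the ideal of that surface. -/
theorem dvd_of_mem_vanishingIdeal {F : MvPolynomial (Fin 4) ℝ} (hF : Irreducible F)
    (hdim : HasRealDim (realSurface F) 2) {H : MvPolynomial (Fin 4) ℝ}
    (hH : H ∈ vanishingIdeal ℝ (coneOver (realSurface F))) : F ∣ H := by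
  set I := vanishingIdeal ℝ (coneOver (realSurface F))
  have hFI : F ∈ I := fun v ⟨hv, hvF⟩ => by
    rw [aeval_eq_eval]
    exact hvF v hv rfl
  by_contra hFH
  have hprime : (Ideal.span {F}).IsPrime :=
    (Ideal.span_singleton_prime hF.ne_zero).mpr hF.prime
  have hdimF : ringKrullDim (MvPolynomial (Fin 4) ℝ ⧸ Ideal.span {F}) + 1 ≤ 4 := by
    refine (ringKrullDim_quotient_succ_le_of_nonZeroDivisor
      (mem_nonZeroDivisors_of_ne_zero hF.ne_zero)).trans ?_
    simp [MvPolynomial.ringKrullDim_of_isNoetherianRing]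
  have hH0 : Ideal.Quotient.mk (Ideal.span {F}) H ≠ 0 := by
    rwa [Ne, Ideal.Quotient.eq_zero_iff_mem, Ideal.mem_span_singleton]
  have hle : Ideal.span {F} ≤ I := (Ideal.span_singleton_le_iff_mem _).mpr hFI
  -- `H` is a nonzero element of the domain `ℝ[x]/(F)` that dies in `ℝ[x]/I`, so the dimension drops
  -- again. With `hdim` this would give `(2 + 1) + 1 + 1 ≤ 4`.
  have hdimI := ringKrullDim_succ_le_of_surjective (Ideal.Quotient.factor hle)
    (Ideal.Quotient.factor_surjective hle) (mem_nonZeroDivisors_of_ne_zero hH0)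
    (by rwa [Ideal.Quotient.factor_mk, Ideal.Quotient.eq_zero_iff_mem])
  rw [hdim] at hdimI
  have h := (add_le_add_left hdimI 1).trans hdimF
  norm_num at h

theorem eval_map_ofReal (F : MvPolynomial (Fin 4) ℝ) (v : Fin 4 → ℝ) :
    eval (fun i => (v i : ℂ)) (map (algebraMap ℝ ℂ) F) = (eval v F : ℝ) := by
  rw [eval_map, ← eval₂_id, ← Complex.ofRealHom_eq_coe, eval₂_comp_left Complex.ofRealHom]
  rfl

/-- Inclusions rather than equalities, so that only the source surface needs irreducibility and
dimension 2. -/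
theorem smul_complexSurface_subset_iff {F G : MvPolynomial (Fin 4) ℝ} {m n : ℕ}
    (hF : F.IsHomogeneous m) (hG : G.IsHomogeneous n)
    (hFirr : Irreducible (map (algebraMap ℝ ℂ) F)) (hR : HasRealDim (realSurface F) 2)
    (φ : PGL(4, ℝ)) :
    φ • complexSurface F ⊆ complexSurface G ↔ φ • realSurface F ⊆ realSurface G := by
  induction φ using Matrix.ProjGenLinGroup.induction_on with | mk g =>
  have hC := smul_zeroLocus_subset_iff (hF.map (algebraMap ℝ ℂ)) (hG.map (algebraMap ℝ ℂ))
    (Matrix.GeneralLinearGroup.map Complex.ofRealHom g)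
  have hval : (Matrix.GeneralLinearGroup.map Complex.ofRealHom g).val =
    g.val.map (algebraMap ℝ ℂ) := rfl
  refine Iff.trans hC (Iff.trans ?_ (smul_zeroLocus_subset_iff hF hG g).symm)
  simp only [hval, ← eval_linearSubst, ← map_linearSubst]
  constructor
  · intro h v hv hvF
    have := h (fun i => (v i : ℂ)) (fun h0 => hv (funext fun i => by
      simpa using congrFun h0 i)) (by rw [eval_map_ofReal, hvF, Complex.ofReal_zero])
    rwa [eval_map_ofReal, Complex.ofReal_eq_zero] at this
  · intro h v _ hvF
    -- The real inclusion says that `G ∘ g` lies in the ideal of `R`; the resulting identity `G ∘ g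
    -- = F * Q` can be evaluated at complex points.
    obtain ⟨Q, hQ⟩ := dvd_of_mem_vanishingIdeal (irreducible_of_irreducible_map_complex hFirr) hR
      (H := linearSubst g.val G) fun v ⟨hv, hvF⟩ => by
        rw [aeval_eq_eval]
        exact h v hv (hvF v hv rfl)
    rw [hQ, map_mul, map_mul, hvF, zero_mul]

/-- The second inclusion is of the same shape with `F` and `G` exchanged and `φ⁻¹` for `φ`. -/
theorem smul_eq_iff_subset {T X : Type*} [Group T] [MulAction T X] (φ : T) (A B : Set X) :
    φ • A = B ↔ φ • A ⊆ B ∧ φ⁻¹ • B ⊆ A := by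
  rw [Set.Subset.antisymm_iff, Set.subset_smul_set_iff]

theorem equivalences_complexSurface_eq {F G : MvPolynomial (Fin 4) ℝ} {m n : ℕ}
    (hF : F.IsHomogeneous m) (hG : G.IsHomogeneous n)
    (hFirr : Irreducible (map (algebraMap ℝ ℂ) F)) (hGirr : Irreducible (map (algebraMap ℝ ℂ) G))
    (hR : HasRealDim (realSurface F) 2) (hS : HasRealDim (realSurface G) 2) (𝓖 : Set PGL(4, ℝ)) :
    equivalences 𝓖 (complexSurface F) (complexSurface G) =
      equivalences 𝓖 (realSurface F) (realSurface G) := by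
  ext φ
  simp only [equivalences, Set.mem_ofPred_eq, smul_eq_iff_subset,
    smul_complexSurface_subset_iff hF hG hFirr hR, smul_complexSurface_subset_iff hG hF hGirr hS]

end SimSurf

theorem mainTheorem6 (F G : MvPolynomial (Fin 4) ℝ) (m n : ℕ)
    (hF : F.IsHomogeneous m) (hG : G.IsHomogeneous n)
    (hFirr : Irreducible (MvPolynomial.map (algebraMap ℝ ℂ) F))
    (hGirr : Irreducible (MvPolynomial.map (algebraMap ℝ ℂ) G))
    (hR : SimSurf.HasRealDim (SimSurf.realSurface F) 2)
    (hS : SimSurf.HasRealDim (SimSurf.realSurface G) 2) :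
    SimSurf.equivalences SimSurf.directSimilarities
        (SimSurf.complexSurface F) (SimSurf.complexSurface G) =
      SimSurf.equivalences SimSurf.directSimilarities
        (SimSurf.realSurface F) (SimSurf.realSurface G) ∧
    SimSurf.equivalences SimSurf.similarities
        (SimSurf.complexSurface F) (SimSurf.complexSurface G) =
      SimSurf.equivalences SimSurf.similarities
        (SimSurf.realSurface F) (SimSurf.realSurface G) :=
  ⟨SimSurf.equivalences_complexSurface_eq hF hG hFirr hGirr hR hS _,
    SimSurf.equivalences_complexSurface_eq hF hG hFirr hGirr hR hS _⟩
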